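/- Let $D$ be the generic poset, i.e. the (unique up to isomorphism) countable poset such that for every finite subposet $X\subseteq D$ and every one-point extension $X\cup\{x\}$ of $X$ to a poset there are $y\in D$ and an isomorphism $X\cup\{x\}\to X\cup\{y\}$ that is the identity on $X$. Let $\operatorname{Aut}(D)$ be the group of order automorphisms of $D$ with the topology of pointwise convergence ($D$ discrete). For $f\in\operatorname{Aut}(D)$ and $x\in D$ write $[x]=\{f^k(x):k\in\mathbb Z\}$. Call $f$ correctly orbitally incomparable if $f^k(x)$ and $x$ are incomparable for all $x\in D$ and $k\in\mathbb Z\setminus\{0\}$, and the relation on orbits of $f$ given by $[x]\preceq[y]$ iff $x'\le y'$ for some $x'\in[x]$, $y'\in[y]$ is a partial order. Let $\mathcal X$ be the set of all correctly orbitally incomparable automorphisms of $D$. Then: (0) $\mathcal X$ is a $G_\delta$ subset of $\operatorname{Aut}(D)$. (i) The set of pairs $(f,g)\in\mathcal X\times\operatorname{Aut}(D)$ such that $f$ and $g$ freely generate a dense subgroup of $\operatorname{Aut}(D)$ is comeager in $\mathcal X\times\operatorname{Aut}(D)$. (ii) For every $m\in\mathbb N$, the set of tuples $(g_1,\dots,g_m)\in\operatorname{Aut}(D)^m$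 that are cyclically dense for the diagonal action, i.e. for which there is $f\in\operatorname{Aut}(D)$ such that $\{(f^kg_1f^{-k},\dots,f^kg_mf^{-k}):k\in\mathbb Z\}$ is dense in $\operatorname{Aut}(D)^m$, is comeager in $\operatorname{Aut}(D)^m$. -/

import Mathlib

namespace GenericPoset

/-- `D` is the generic poset: it is countable, and every one-point extension of a finite
subposet `X` of `D` is realized in `D` over `X`. A one-point extension of `X` is a partial order
on `Option X` (with `none` as the new point) that restricts to the order of `X`; it is realized
by an order isomorphism `e` onto a subposet of `D` that is the identity on `X`. -/
structure IsGeneric (D : Type*) [PartialOrder D] : Prop where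
  countable : Countable D
  exists_extension : ∀ (X : Finset D) (P : PartialOrder (Option X)),
    (∀ a b : X, P.le (some a) (some b) ↔ (a : D) ≤ b) →
      ∃ e : Option X → D, (∀ u v, e u ≤ e v ↔ P.le u v) ∧ ∀ a : X, e (some a) = a

/-- The topology of pointwise convergence on the automorphism group of a poset: the topology
inherited from `D → D`, where `D` is discrete. -/
instance autTopology (D : Type*) [LE D] : TopologicalSpace (D ≃o D) :=
  TopologicalSpace.induced (fun (f : D ≃o D) (x : D) => f x)
    (@Pi.topologicalSpace D (fun _ => D) (fun _ => ⊥))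

/-- The orbit `[x]` of the point `x` under the automorphism `f`. -/
def orbit {D : Type*} [PartialOrder D] (f : D ≃o D) (x : D) : Set D :=
  Set.range fun k : ℤ => (f ^ k) x

/-- The relation `[x] ≼ [y]` on the orbits of `f`: some element of `[x]` is at most some element
of `[y]`. -/
def orbitLE {D : Type*} [PartialOrder D] (f : D ≃o D) (A B : Set.range (orbit f)) : Prop :=
  ∃ a ∈ (A : Set D), ∃ b ∈ (B : Set D), a ≤ b

/-- `f` is orbitally incomparable: `f ^ k x` and `x` are incomparable for all `x` and `k ≠ 0`. -/
def OrbitallyIncomparable {D : Type*} [PartialOrder D] (f : D ≃o D) : Prop :=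
  ∀ (x : D) (k : ℤ), k ≠ 0 → ¬ (f ^ k) x ≤ x ∧ ¬ x ≤ (f ^ k) x

/-- `f` is correctly orbitally incomparable: it is orbitally incomparable and `≼` is a partial
order on the set of orbits of `f`. -/
def CorrectlyOrbitallyIncomparable {D : Type*} [PartialOrder D] (f : D ≃o D) : Prop :=
  OrbitallyIncomparable f ∧ IsPartialOrder (Set.range (orbit f)) (orbitLE f)

/-- The set of correctly orbitally incomparable automorphisms of `D`. -/
def coiAut (D : Type*) [PartialOrder D] : Set (D ≃o D) :=
  {f | CorrectlyOrbitallyIncomparable f}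

/-- `f` and `g` freely generate a dense subgroup of `G`. -/
def FreelyGenerateDense {G : Type*} [Group G] [TopologicalSpace G] (f g : G) : Prop :=
  Function.Injective (FreeGroup.lift ![f, g]) ∧ Dense (Subgroup.closure {f, g} : Set G)

/-- The tuple `g` is cyclically dense for the diagonal action of `G` on `G ^ m` (by simultaneous
conjugation). -/
def CyclicallyDense {G : Type*} [Group G] [TopologicalSpace G] {m : ℕ} (g : Fin m → G) : Prop :=
  ∃ f : G, Dense (Set.range fun (k : ℤ) (i : Fin m) => f ^ k * g i * f ^ (-k))

end GenericPoset

/-! ### Extension property and back and forth -/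

namespace GenericPoset

/-! The central notion is that of a dispersing automorphism `f`: its orbits are antichains, and each
point is comparable with only finitely many points of each orbit. Some power `f ^ n` then carries
any given finite set to a set having no comparabilities with it. So for finite `A`, `C` and
automorphisms `g`, `h`, the map `g` on `A` together with the `f ^ n`-conjugate of `h` on `f ^ n C`
is a partial isomorphism, and back and forth extends it to some `g'` with `f ^ (-n) * g' * f ^ n =
h` on `C` (`exists_agree_conj`). This yields countably many dense open conditions, which give
density of conjugates.

For cyclic density one fixed dispersing `f` suffices. For pairs, dispersing automorphisms must be
dense in `coiAut D` (`exists_isDispersing_agree`): the order of `D` is thinned invariantly,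
unchanged on a given finite set, until `f` disperses; then free orbits are added until the extension
property holds again (`IsDispersed.exists_extRel`), and the result is identified with `D` over the
finite set.

Freeness comes from building `g` along a reduced word so that the path of a point never returns to
its start (`exists_wordVal_fresh`). Finally, orbital incomparability already implies correctness, so
`coiAut D` is cut out by countably many open conditions. -/

/-- Every consistent finite system of bounds `L < z < U` has a solution `z` which is related to the
points of a given finite set `F` only as far as this is forced by the bounds. -/
def ExtRel {α : Type*} (R : α → α → Prop) : Prop :=
  ∀ L U F : Finset α, (∀ l ∈ L, ∀ u ∈ U, R l u ∧ l ≠ u) →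
    ∃ z, ∀ a ∈ F, (R a z ↔ ∃ l ∈ L, R a l) ∧ (R z a ↔ ∃ u ∈ U, R u a)

/-- The order forced on `F` and a new point is already transitive: a chain passing through the new
point is bridged by some `l < u`. The bounds in `L` and `U` need not lie in `F`. -/
theorem IsGeneric.extRel {D : Type*} [PartialOrder D] (hD : IsGeneric D) :
    ExtRel (fun x y : D => x ≤ y) := by
  classical
  intro L U F hLU
  have hlt : ∀ l ∈ L, ∀ u ∈ U, ¬ u ≤ l := fun l hl u hu h =>
    (hLU l hl u hu).2 (le_antisymm (hLU l hl u hu).1 h)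
  let le : Option F → Option F → Prop := fun s t =>
    match s, t with
    | none, none => True
    | some a, some b => (a : D) ≤ b
    | some a, none => ∃ l ∈ L, (a : D) ≤ l
    | none, some b => ∃ u ∈ U, u ≤ (b : D)
  let P : PartialOrder (Option F) :=
    { le := le
      lt := fun a b => le a b ∧ ¬ le b a
      lt_iff_le_not_ge := fun _ _ => Iff.rfl
      le_refl := by rintro (_ | a) <;> simp [le]
      le_trans := by
        rintro (_ | a) (_ | b) (_ | c) h1 h2
        · trivial
        · exact h2
        · trivial
        · obtain ⟨u, hu, h⟩ := h1
          exact ⟨u, hu, h.trans h2⟩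
        · exact h1
        · obtain ⟨l, hl, h⟩ := h1
          obtain ⟨u, hu, h'⟩ := h2
          exact h.trans ((hLU l hl u hu).1.trans h')
        · obtain ⟨l, hl, h⟩ := h2
          exact ⟨l, hl, le_trans h1 h⟩
        · exact le_trans h1 h2
      le_antisymm := by
        rintro (_ | a) (_ | b) h1 h2
        · rfl
        · obtain ⟨u, hu, h⟩ := h1
          obtain ⟨l, hl, h'⟩ := h2
          exact (hlt l hl u hu (h.trans h')).elim
        · obtain ⟨u, hu, h⟩ := h2
          obtain ⟨l, hl, h'⟩ := h1
          exact (hlt l hl u hu (h.trans h')).elim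
        · exact congrArg some (Subtype.ext (le_antisymm h1 h2)) }
  obtain ⟨e, he, hX⟩ := hD.exists_extension F P (fun a b => Iff.rfl)
  refine ⟨e none, fun a ha => ?_⟩
  have h1 := he (some ⟨a, ha⟩) none
  have h2 := he none (some ⟨a, ha⟩)
  rw [hX] at h1 h2
  exact ⟨h1, h2⟩

/-- A finite set of pairs is the graph of an isomorphism between finite subposets. -/
def IsPartialIso {α β : Type*} [LE α] [LE β] (s : Finset (α × β)) : Prop :=
  ∀ p ∈ s, ∀ q ∈ s, p.1 ≤ q.1 ↔ p.2 ≤ q.2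

section BackAndForth

variable {α β : Type*} [PartialOrder α] [PartialOrder β]

/-- The images of the points of `s` below and above `a` form a consistent system of bounds; any
solution free over these images and `G` is a possible value at `a`. -/
theorem IsPartialIso.exists_insert_fresh [DecidableEq α] [DecidableEq β]
    (hβ : ExtRel (fun x y : β => x ≤ y)) {s : Finset (α × β)} (hs : IsPartialIso s) (a : α)
    (ha : ∀ p ∈ s, p.1 ≠ a) (G : Finset β) : ∃ b ∉ G, IsPartialIso (insert (a, b) s) := by
  classical
  have hLU : ∀ l ∈ (s.filter fun p => p.1 ≤ a).image Prod.snd,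
      ∀ u ∈ (s.filter fun p => a ≤ p.1).image Prod.snd, l ≤ u ∧ l ≠ u := by
    simp only [Finset.mem_image, Finset.mem_filter]
    rintro _ ⟨p, ⟨hp, hpa⟩, rfl⟩ _ ⟨q, ⟨hq, hqa⟩, rfl⟩
    refine ⟨(hs p hp q hq).1 (hpa.trans hqa), fun h => ha p hp ?_⟩
    exact le_antisymm hpa (hqa.trans ((hs q hq p hp).2 h.ge))
  obtain ⟨b, hb⟩ := hβ _ _ (G ∪ s.image Prod.snd) hLU
  beta_reduce at hb
  have h1 : ∀ p ∈ s, p.2 ≤ b ↔ p.1 ≤ a := by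
    intro p hp
    rw [(hb p.2 (Finset.mem_union_right _ (Finset.mem_image_of_mem _ hp))).1]
    simp only [Finset.mem_image, Finset.mem_filter]
    constructor
    · rintro ⟨_, ⟨q, ⟨hq, hqa⟩, rfl⟩, h⟩
      exact ((hs p hp q hq).2 h).trans hqa
    · exact fun h => ⟨p.2, ⟨p, ⟨hp, h⟩, rfl⟩, le_rfl⟩
  have h2 : ∀ p ∈ s, b ≤ p.2 ↔ a ≤ p.1 := by
    intro p hp
    rw [(hb p.2 (Finset.mem_union_right _ (Finset.mem_image_of_mem _ hp))).2]
    simp only [Finset.mem_image, Finset.mem_filter]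
    constructor
    · rintro ⟨_, ⟨q, ⟨hq, hqa⟩, rfl⟩, h⟩
      exact hqa.trans ((hs q hq p hp).2 h)
    · exact fun h => ⟨p.2, ⟨p, ⟨hp, h⟩, rfl⟩, le_rfl⟩
  refine ⟨b, fun hbG => ?_, ?_⟩
  -- A solution free over a set containing itself would satisfy `b ≤ l` and `u ≤ b`, against `l <
  -- u`.
  · have := hb b (Finset.mem_union_left _ hbG)
    obtain ⟨l, hl, hbl⟩ := this.1.1 le_rfl
    obtain ⟨u, hu, hub⟩ := this.2.1 le_rfl
    exact (hLU l hl u hu).2 (le_antisymm (hLU l hl u hu).1 (hub.trans hbl))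
  · intro p hp q hq
    rw [Finset.mem_insert] at hp hq
    rcases hp with rfl | hp <;> rcases hq with rfl | hq
    · simp
    · exact (h2 q hq).symm
    · exact (h1 p hp).symm
    · exact hs p hp q hq

theorem IsPartialIso.exists_insert [DecidableEq α] [DecidableEq β]
    (hβ : ExtRel (fun x y : β => x ≤ y)) {s : Finset (α × β)} (hs : IsPartialIso s) (a : α) :
    ∃ b, IsPartialIso (insert (a, b) s) := by
  by_cases ha : ∀ p ∈ s, p.1 ≠ a
  · obtain ⟨b, -, hb⟩ := hs.exists_insert_fresh hβ a ha ∅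
    exact ⟨b, hb⟩
  · push Not at ha
    obtain ⟨p, hp, rfl⟩ := ha
    exact ⟨p.2, by rwa [Finset.insert_eq_of_mem (by simpa using hp)]⟩

theorem IsPartialIso.swap [DecidableEq α] [DecidableEq β] {s : Finset (α × β)}
    (hs : IsPartialIso s) : IsPartialIso (s.image Prod.swap) := by
  intro p hp q hq
  rw [Finset.mem_image] at hp hq
  obtain ⟨p, hp, rfl⟩ := hp
  obtain ⟨q, hq, rfl⟩ := hq
  exact (hs p hp q hq).symm

/-- Back and forth: a finite partial isomorphism between countable posets with the extension
property extends to an isomorphism. -/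
theorem IsPartialIso.exists_orderIso [Countable α] [Countable β]
    (hα : ExtRel (fun x y : α => x ≤ y)) (hβ : ExtRel (fun x y : β => x ≤ y))
    {s : Finset (α × β)} (hs : IsPartialIso s) : ∃ e : α ≃o β, ∀ p ∈ s, e p.1 = p.2 := by
  classical
  have := Encodable.ofCountable α
  have := Encodable.ofCountable β
  let S := {t : Finset (α × β) // IsPartialIso t}
  let cof : α ⊕ β → Order.Cofinal S := fun c =>
    match c with
    | .inl a =>
      { carrier := {t | ∃ b, (a, b) ∈ t.1}
        isCofinal := fun t => by
          obtain ⟨b, hb⟩ := t.2.exists_insert hβ a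
          exact ⟨⟨_, hb⟩, ⟨b, Finset.mem_insert_self _ _⟩, Finset.subset_insert _ _⟩ }
    | .inr b =>
      { carrier := {t | ∃ a, (a, b) ∈ t.1}
        isCofinal := fun t => by
          obtain ⟨a, ha⟩ := t.2.swap.exists_insert hα b
          refine ⟨⟨_, ha.swap⟩, ⟨a, ?_⟩, ?_⟩
          · rw [Finset.mem_image]
            exact ⟨(b, a), Finset.mem_insert_self _ _, rfl⟩
          · intro p hp
            rw [Finset.mem_image]
            exact ⟨p.swap, Finset.mem_insert_of_mem (Finset.mem_image_of_mem _ hp), p.swap_swap⟩ }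
  let I := Order.idealOfCofinals (⟨s, hs⟩ : S) cof
  have hI : ∀ p q : α × β, (∃ t ∈ I, p ∈ t.1) → (∃ t ∈ I, q ∈ t.1) →
      (p.1 ≤ q.1 ↔ p.2 ≤ q.2) := by
    rintro p q ⟨t, ht, hp⟩ ⟨t', ht', hq⟩
    obtain ⟨w, -, h1, h2⟩ := I.directed t ht t' ht'
    exact w.2 p (h1 hp) q (h2 hq)
  have hF : ∀ a, ∃ b, ∃ t ∈ I, (a, b) ∈ t.1 := fun a => by
    obtain ⟨t, ⟨b, hb⟩, ht⟩ := Order.cofinal_meets_idealOfCofinals (⟨s, hs⟩ : S) cof (.inl a)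
    exact ⟨b, t, ht, hb⟩
  have hG : ∀ b, ∃ a, ∃ t ∈ I, (a, b) ∈ t.1 := fun b => by
    obtain ⟨t, ⟨a, ha⟩, ht⟩ := Order.cofinal_meets_idealOfCofinals (⟨s, hs⟩ : S) cof (.inr b)
    exact ⟨a, t, ht, ha⟩
  choose F hF using hF
  choose G hG using hG
  refine ⟨{ toFun := F, invFun := G, left_inv := fun a => ?_, right_inv := fun b => ?_,
            map_rel_iff' := fun {a b} => (hI _ _ (hF a) (hF b)).symm }, fun p hp => ?_⟩
  · exact le_antisymm ((hI _ _ (hG (F a)) (hF a)).2 le_rfl) ((hI _ _ (hF a) (hG (F a))).2 le_rfl)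
  · exact le_antisymm ((hI _ _ (hF (G b)) (hG b)).1 le_rfl) ((hI _ _ (hG b) (hF (G b))).1 le_rfl)
  · have hp' : ∃ t ∈ I, p ∈ t.1 := ⟨_, Order.mem_idealOfCofinals _ _, hp⟩
    exact le_antisymm ((hI _ _ (hF p.1) hp').1 le_rfl) ((hI _ _ hp' (hF p.1)).1 le_rfl)

theorem exists_orderIso_of_finite [Countable α] [Countable β]
    (hα : ExtRel (fun x y : α => x ≤ y)) (hβ : ExtRel (fun x y : β => x ≤ y))
    {ι : Type*} [Finite ι] (u : ι → α) (v : ι → β) (h : ∀ i j, u i ≤ u j ↔ v i ≤ v j) :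
    ∃ e : α ≃o β, ∀ i, e (u i) = v i := by
  classical
  have := Fintype.ofFinite ι
  have hs : IsPartialIso (Finset.univ.image fun i => (u i, v i)) := by
    intro p hp q hq
    rw [Finset.mem_image] at hp hq
    obtain ⟨i, -, rfl⟩ := hp
    obtain ⟨j, -, rfl⟩ := hq
    exact h i j
  obtain ⟨e, he⟩ := hs.exists_orderIso hα hβ
  exact ⟨e, fun i => he (u i, v i) (Finset.mem_image_of_mem _ (Finset.mem_univ i))⟩

end BackAndForth

theorem IsGeneric.exists_agree_fresh {D : Type*} [PartialOrder D] (hD : IsGeneric D) (g : D ≃o D)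
    (A : Finset D) {y : D} (hy : y ∉ A) (G : Finset D) :
    ∃ g' : D ≃o D, (∀ a ∈ A, g' a = g a) ∧ g' y ∉ G := by
  classical
  have := hD.countable
  have hs : IsPartialIso (A.image fun a => (a, g a)) := by
    intro p hp q hq
    rw [Finset.mem_image] at hp hq
    obtain ⟨a, -, rfl⟩ := hp
    obtain ⟨b, -, rfl⟩ := hq
    exact (g.le_iff_le).symm
  obtain ⟨b, hb, h⟩ := hs.exists_insert_fresh hD.extRel y (by
    rintro p hp rfl
    rw [Finset.mem_image] at hp
    obtain ⟨a, ha, rfl⟩ := hp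
    exact hy ha) G
  obtain ⟨e, he⟩ := h.exists_orderIso hD.extRel hD.extRel
  refine ⟨e, fun a ha => ?_, ?_⟩
  · exact he (a, g a) (Finset.mem_insert_of_mem (Finset.mem_image_of_mem _ ha))
  · rw [he (y, b) (Finset.mem_insert_self _ _)]
    exact hb

theorem IsGeneric.exists_notMem {D : Type*} [PartialOrder D] (hD : IsGeneric D) (F : Finset D) :
    ∃ x, x ∉ F := by
  obtain ⟨z, hz⟩ := hD.extRel ∅ ∅ F (by simp)
  exact ⟨z, fun h => by simpa using (hz z h).1⟩


/-! ### Dispersed `ℤ`-posets: adding one free orbit -/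

/-- `R` is a partial order on `T` invariant under the action `φ` of `ℤ`, such that orbits are free
antichains, and every point is comparable with only finitely many points of each orbit. -/
structure IsDispersed {T : Type*} (φ : ℤ → T → T) (R : T → T → Prop) : Prop where
  zero : ∀ x, φ 0 x = x
  add : ∀ a b x, φ (a + b) x = φ a (φ b x)
  refl : ∀ x, R x x
  trans : ∀ x y z, R x y → R y z → R x z
  antisymm : ∀ x y, R x y → R y x → x = y
  inv : ∀ k x y, R x y → R (φ k x) (φ k y)
  free : ∀ k x, R x (φ k x) → k = 0
  finite : ∀ x y, {k : ℤ | R x (φ k y)}.Finite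

/-- The order obtained from `R` by placing the point `φ k z` above `φ k l` for `l ∈ L` and below
`φ k u` for `u ∈ U`, for all `k`. -/
def addOrbit {T : Type*} (φ : ℤ → T → T) (R : T → T → Prop) (z : T) (L U : Finset T)
    (x y : T) : Prop :=
  R x y ∨ (∃ k, y = φ k z ∧ ∃ l ∈ L, R x (φ k l)) ∨ ∃ k, x = φ k z ∧ ∃ u ∈ U, R (φ k u) y

namespace IsDispersed

variable {T : Type*} {φ : ℤ → T → T} {R : T → T → Prop}

theorem eq_of_act_eq (h : IsDispersed φ R) {j k : ℤ} {z : T} (e : φ j z = φ k z) : j = k := by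
  have h1 : φ (-j + k) z = z := by rw [h.add, ← e, ← h.add, neg_add_cancel, h.zero]
  have := h.free (-j + k) z (by rw [h1]; exact h.refl z)
  omega

theorem eq_of_rel (h : IsDispersed φ R) {j k : ℤ} {z : T} (e : R (φ j z) (φ k z)) : j = k := by
  have h1 := h.inv (-j) _ _ e
  rw [← h.add, ← h.add, neg_add_cancel, h.zero] at h1
  have := h.free _ z h1
  omega

theorem rel_act_iff (h : IsDispersed φ R) (k : ℤ) (x y : T) : R (φ k x) (φ k y) ↔ R x y := by
  refine ⟨fun e => ?_, h.inv k x y⟩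
  have h1 := h.inv (-k) _ _ e
  rwa [← h.add, ← h.add, neg_add_cancel, h.zero, h.zero] at h1

theorem finite_left (h : IsDispersed φ R) (x y : T) : {k : ℤ | R (φ k x) y}.Finite := by
  refine ((h.finite x y).image Neg.neg).subset fun k hk => ⟨-k, ?_, neg_neg k⟩
  have h1 := h.inv (-k) _ _ hk
  rwa [← h.add, neg_add_cancel, h.zero] at h1

/-- Freeness of the action makes the exponent of a new point unique, so a passage from below to
above the point `φ k z` reduces to `l < u` translated by `k`. Finiteness survives because `L` and
`U` are finite. -/
theorem addOrbit (h : IsDispersed φ R) {z : T} {L U : Finset T}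
    (hz : ∀ k x, R x (φ k z) ∨ R (φ k z) x → x = φ k z)
    (hL : ∀ l ∈ L, ∀ k, l ≠ φ k z) (hU : ∀ u ∈ U, ∀ k, u ≠ φ k z)
    (hLU : ∀ l ∈ L, ∀ u ∈ U, R l u ∧ l ≠ u) : IsDispersed φ (addOrbit φ R z L U) := by
  have hne : ∀ x : T, (∀ k, x ≠ φ k z) → ∀ j k, φ j x ≠ φ k z := by
    intro x hx j k e
    refine hx (-j + k) ?_
    rw [h.add, ← e, ← h.add, neg_add_cancel, h.zero]
  have hzL : ∀ l ∈ L, ∀ j k, ¬ R (φ k z) (φ j l) := fun l hl j k e =>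
    hne l (hL l hl) j k (hz k _ (.inr e))
  have hUz : ∀ u ∈ U, ∀ j k, ¬ R (φ j u) (φ k z) := fun u hu j k e =>
    hne u (hU u hu) j k (hz k _ (.inl e))
  refine ⟨h.zero, h.add, fun x => .inl (h.refl x), ?_, ?_, ?_, ?_, ?_⟩
  · rintro x y w (h1 | ⟨k, rfl, l, hl, h1⟩ | ⟨k, rfl, u, hu, h1⟩)
      (h2 | ⟨j, e, l', hl', h2⟩ | ⟨j, e, u', hu', h2⟩)
    · exact .inl (h.trans _ _ _ h1 h2)
    · exact .inr (.inl ⟨j, e, l', hl', h.trans _ _ _ h1 h2⟩)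
    · subst e
      rw [hz j x (.inl h1)]
      exact .inr (.inr ⟨j, rfl, u', hu', h2⟩)
    · rw [hz k w (.inr h2)]
      exact .inr (.inl ⟨k, rfl, l, hl, h1⟩)
    · exact (hzL l' hl' j k h2).elim
    · obtain rfl := h.eq_of_act_eq e
      exact .inl (h.trans _ _ _ h1 (h.trans _ _ _ (h.inv k _ _ (hLU l hl u' hu').1) h2))
    · exact .inr (.inr ⟨k, rfl, u, hu, h.trans _ _ _ h1 h2⟩)
    · subst e
      -- Going up from `φ k z` and back to `φ j z` gives `φ k l' ≤ φ j l'`, which forces `k = j`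
      -- since orbits are antichains.
      have h3 := h.trans _ _ _ (h.inv k _ _ (hLU l' hl' u hu).1) (h.trans _ _ _ h1 h2)
      rw [h.eq_of_rel h3]
      exact .inl (h.refl _)
    · subst e
      exact (hUz u hu k j h1).elim
  · rintro x y (h1 | ⟨k, rfl, l, hl, h1⟩ | ⟨k, rfl, u, hu, h1⟩)
      (h2 | ⟨j, e, l', hl', h2⟩ | ⟨j, e, u', hu', h2⟩)
    · exact h.antisymm _ _ h1 h2
    · subst e
      exact (hz j y (.inr h1)).symm
    · subst e
      exact hz j x (.inl h1)
    · exact hz k x (.inr h2)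
    · subst e
      exact (hzL l hl k j h1).elim
    · obtain rfl := h.eq_of_act_eq e
      have h3 := h.trans _ _ _ h2 h1
      rw [h.rel_act_iff] at h3
      exact ((hLU l hl u' hu').2 (h.antisymm _ _ (hLU l hl u' hu').1 h3)).elim
    · exact (hz k y (.inl h2)).symm
    · obtain rfl := h.eq_of_act_eq e
      have h3 := h.trans _ _ _ h1 h2
      rw [h.rel_act_iff] at h3
      exact ((hLU l' hl' u hu).2 (h.antisymm _ _ (hLU l' hl' u hu).1 h3)).elim
    · subst e
      exact (hUz u hu k j h1).elim
  · rintro k x y (h1 | ⟨j, rfl, l, hl, h1⟩ | ⟨j, rfl, u, hu, h1⟩)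
    · exact .inl (h.inv k _ _ h1)
    · refine .inr (.inl ⟨k + j, (h.add _ _ _).symm, l, hl, ?_⟩)
      rw [h.add]
      exact h.inv k _ _ h1
    · refine .inr (.inr ⟨k + j, (h.add _ _ _).symm, u, hu, ?_⟩)
      rw [h.add]
      exact h.inv k _ _ h1
  · rintro k x (h1 | ⟨j, e, l, hl, h1⟩ | ⟨j, rfl, u, hu, h1⟩)
    · exact h.free k x h1
    · have hx : x = φ (-k + j) z := by rw [h.add, ← e, ← h.add, neg_add_cancel, h.zero]
      rw [hx] at h1
      exact (hzL l hl _ _ h1).elim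
    · rw [← h.add] at h1
      exact (hUz u hu _ _ h1).elim
  · intro x y
    have hA : {k : ℤ | ∃ j, φ k y = φ j z ∧ ∃ l ∈ L, R x (φ j l)}.Finite := by
      by_cases hy : ∃ i, y = φ i z
      · obtain ⟨i, rfl⟩ := hy
        refine (L.finite_toSet.biUnion fun l _ => h.finite x (φ i l)).subset ?_
        rintro k ⟨j, e, l, hl, h1⟩
        rw [← h.add] at e
        rw [← h.eq_of_act_eq e, h.add] at h1
        exact Set.mem_biUnion hl h1
      · refine Set.finite_empty.subset ?_
        rintro k ⟨j, e, -⟩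
        exact (hne y (fun i hi => hy ⟨i, hi⟩) k j e).elim
    have hB : {k : ℤ | ∃ j, x = φ j z ∧ ∃ u ∈ U, R (φ j u) (φ k y)}.Finite := by
      by_cases hx : ∃ i, x = φ i z
      · obtain ⟨i, rfl⟩ := hx
        refine (U.finite_toSet.biUnion fun u _ => h.finite (φ i u) y).subset ?_
        rintro k ⟨j, e, u, hu, h1⟩
        rw [← h.eq_of_act_eq e] at h1
        exact Set.mem_biUnion hu h1
      · refine Set.finite_empty.subset ?_
        rintro k ⟨j, e, -⟩
        exact (hx ⟨j, e⟩).elim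
    exact (((h.finite x y).union (hA.union hB))).subset fun k hk => hk

end IsDispersed

/-! ### Adding orbits until the extension property holds -/

section Extension

variable {B : Type*}

/-- The action of `ℤ` on `B` extended by countably many free orbits. -/
def extAct (φ : ℤ → B → B) (k : ℤ) : B ⊕ ℕ × ℤ → B ⊕ ℕ × ℤ
  | .inl b => .inl (φ k b)
  | .inr (n, j) => .inr (n, k + j)

/-- The order on `B` extended by an antichain. -/
def baseRel (r : B → B → Prop) : B ⊕ ℕ × ℤ → B ⊕ ℕ × ℤ → Prop
  | .inl a, .inl b => r a b
  | .inr p, .inr q => p = q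
  | _, _ => False

/-- The points outside the new orbits with index at least `n`. -/
def Old (n : ℕ) : B ⊕ ℕ × ℤ → Prop
  | .inl _ => True
  | .inr (m, _) => m < n

open Classical in
/-- The order after the first `n` new orbits are placed as prescribed by `τ`. -/
def stageRel (φ : ℤ → B → B) (r : B → B → Prop)
    (τ : ℕ → Finset (B ⊕ ℕ × ℤ) × Finset (B ⊕ ℕ × ℤ)) : ℕ → B ⊕ ℕ × ℤ → B ⊕ ℕ × ℤ → Prop
  | 0 => baseRel r
  | n + 1 =>
    if (∀ l ∈ (τ n).1, Old n l) ∧ (∀ u ∈ (τ n).2, Old n u) ∧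
        ∀ l ∈ (τ n).1, ∀ u ∈ (τ n).2, stageRel φ r τ n l u ∧ l ≠ u then
      addOrbit (extAct φ) (stageRel φ r τ n) (.inr (n, 0)) (τ n).1 (τ n).2
    else stageRel φ r τ n

variable {φ : ℤ → B → B} {r : B → B → Prop}

theorem isDispersed_baseRel (h : IsDispersed φ r) : IsDispersed (extAct φ) (baseRel r) := by
  refine ⟨?_, ?_, ?_, ?_, ?_, ?_, ?_, ?_⟩
  · rintro (x | ⟨n, j⟩)
    · exact congrArg _ (h.zero x)
    · simp [extAct]
  · rintro a b (x | ⟨n, j⟩)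
    · exact congrArg _ (h.add a b x)
    · simp [extAct, add_assoc]
  · rintro (x | ⟨n, j⟩)
    · exact h.refl x
    · rfl
  · rintro (x | x) (y | y) (z | z) h1 h2
    all_goals first | exact h1.elim | exact h2.elim | exact h.trans _ _ _ h1 h2 | exact Eq.trans h1 h2
  · rintro (x | x) (y | y) h1 h2
    all_goals first | exact h1.elim | exact congrArg _ (h.antisymm _ _ h1 h2) | exact congrArg _ h1
  · rintro k (x | x) (y | y) h1
    · exact h.inv k _ _ h1
    · exact h1.elim
    · exact h1.elim
    · obtain rfl : x = y := h1
      rfl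
  · rintro k (x | ⟨n, j⟩) h1
    · exact h.free k x h1
    · have : (n, j) = (n, k + j) := h1
      simpa using this
  · rintro (x | x) (y | ⟨n, j⟩)
    · exact h.finite x y
    · exact Set.finite_empty.subset fun k hk => hk
    · exact Set.finite_empty.subset fun k hk => hk
    · refine (Set.finite_singleton (x.2 - j)).subset fun k hk => ?_
      have h1 : x = (n, k + j) := hk
      simp [h1]

/-- The second clause keeps the orbits not yet treated isolated, as `IsDispersed.addOrbit` requires.
-/
theorem isDispersed_stageRel (h : IsDispersed φ r)
    (τ : ℕ → Finset (B ⊕ ℕ × ℤ) × Finset (B ⊕ ℕ × ℤ)) (n : ℕ) :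
    IsDispersed (extAct φ) (stageRel φ r τ n) ∧ ∀ m ≥ n, ∀ k x,
      stageRel φ r τ n x (.inr (m, k)) ∨ stageRel φ r τ n (.inr (m, k)) x → x = .inr (m, k) := by
  induction n with
  | zero =>
    refine ⟨isDispersed_baseRel h, ?_⟩
    rintro m - k (x | x) (h1 | h1)
    · exact h1.elim
    · exact h1.elim
    · exact congrArg _ h1
    · exact congrArg _ (Eq.symm h1)
  | succ n ih =>
    obtain ⟨ih1, ih2⟩ := ih
    have hz : ∀ m k, extAct φ k (.inr (m, 0)) = .inr (m, k) := by simp [extAct]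
    rw [stageRel]
    split_ifs with hc
    · have hold : ∀ x : B ⊕ ℕ × ℤ, Old n x → ∀ m ≥ n, ∀ k, x ≠ .inr (m, k) := by
        rintro _ hx m hm k rfl
        exact absurd hx (not_lt.2 hm)
      have hold' : ∀ x : B ⊕ ℕ × ℤ, Old n x → ∀ m ≥ n, ∀ j k, extAct φ j x ≠ .inr (m, k) := by
        rintro (x | ⟨i, x⟩) hx m hm j k e
        · simp [extAct] at e
        · simp only [extAct, Sum.inr.injEq, Prod.mk.injEq] at e
          exact absurd hx (not_lt.2 (e.1 ▸ hm))
      refine ⟨ih1.addOrbit (fun k x => ?_) (fun l hl k => ?_) (fun u hu k => ?_) hc.2.2, ?_⟩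
      · rw [hz]
        exact ih2 n le_rfl k x
      · rw [hz]
        exact hold l (hc.1 l hl) n le_rfl k
      · rw [hz]
        exact hold u (hc.2.1 u hu) n le_rfl k
      · intro m hm k x hx
        have hmn : m ≠ n := by omega
        rcases hx with (h1 | ⟨j, e, l, hl, h1⟩ | ⟨j, rfl, u, hu, h1⟩) |
          (h1 | ⟨j, rfl, l, hl, h1⟩ | ⟨j, e, u, hu, h1⟩)
        · exact ih2 m (by omega) k x (.inl h1)
        · rw [hz] at e
          simp [hmn] at e
        · exact (hold' u (hc.2.1 u hu) m (by omega) _ _ (ih2 m (by omega) k _ (.inl h1))).elim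
        · exact ih2 m (by omega) k x (.inr h1)
        · exact (hold' l (hc.1 l hl) m (by omega) _ _ (ih2 m (by omega) k _ (.inr h1))).elim
        · rw [hz] at e
          simp [hmn] at e
    · exact ⟨ih1, fun m hm => ih2 m (by omega)⟩

theorem stageRel_succ_of (τ : ℕ → Finset (B ⊕ ℕ × ℤ) × Finset (B ⊕ ℕ × ℤ)) {n : ℕ}
    {x y : B ⊕ ℕ × ℤ} (h : stageRel φ r τ n x y) : stageRel φ r τ (n + 1) x y := by
  rw [stageRel]
  split_ifs
  · exact .inl h
  · exact h

theorem stageRel_mono (τ : ℕ → Finset (B ⊕ ℕ × ℤ) × Finset (B ⊕ ℕ × ℤ)) {m n : ℕ} (hmn : m ≤ n)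
    {x y : B ⊕ ℕ × ℤ} (h : stageRel φ r τ m x y) : stageRel φ r τ n x y := by
  induction n, hmn using Nat.le_induction with
  | base => exact h
  | succ n _ ih => exact stageRel_succ_of τ ih

theorem stageRel_of_succ (τ : ℕ → Finset (B ⊕ ℕ × ℤ) × Finset (B ⊕ ℕ × ℤ)) {n : ℕ}
    {x y : B ⊕ ℕ × ℤ} (hx : Old n x) (hy : Old n y) (h : stageRel φ r τ (n + 1) x y) :
    stageRel φ r τ n x y := by
  rw [stageRel] at h
  split_ifs at h
  · rcases h with h | ⟨k, rfl, -⟩ | ⟨k, rfl, -⟩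
    · exact h
    · exact absurd hy (lt_irrefl n)
    · exact absurd hx (lt_irrefl n)
  · exact h

theorem Old.mono {m n : ℕ} (hmn : m ≤ n) {x : B ⊕ ℕ × ℤ} (hx : Old m x) : Old n x := by
  rcases x with x | ⟨i, x⟩
  · trivial
  · exact lt_of_lt_of_le hx hmn

/-- Placing a new orbit creates no relation between old points, so the union of all stages restricts
to each stage on its old points. -/
theorem stageRel_of_old (τ : ℕ → Finset (B ⊕ ℕ × ℤ) × Finset (B ⊕ ℕ × ℤ)) {m n : ℕ}
    {x y : B ⊕ ℕ × ℤ} (hx : Old m x) (hy : Old m y) (h : stageRel φ r τ n x y) :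
    stageRel φ r τ m x y := by
  induction n with
  | zero => exact stageRel_mono τ (Nat.zero_le m) h
  | succ n ih =>
    rcases le_or_gt (n + 1) m with hm | hm
    · exact stageRel_mono τ hm h
    · exact ih (stageRel_of_succ τ (hx.mono (by omega)) (hy.mono (by omega)) h)

theorem exists_old (x : B ⊕ ℕ × ℤ) : ∃ n, Old n x := by
  rcases x with x | ⟨i, x⟩
  · exact ⟨0, trivial⟩
  · exact ⟨i + 1, Nat.lt_succ_self i⟩

theorem Old.act {n : ℕ} {x : B ⊕ ℕ × ℤ} (hx : Old n x) (k : ℤ) : Old n (extAct φ k x) := by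
  rcases x with x | ⟨i, x⟩
  · trivial
  · exact hx

theorem exists_old_finset (F : Finset (B ⊕ ℕ × ℤ)) : ∃ n, ∀ x ∈ F, Old n x := by
  choose N hN using (exists_old : ∀ x : B ⊕ ℕ × ℤ, _)
  exact ⟨F.sup N, fun x hx => (hN x).mono (Finset.le_sup hx)⟩

/-- Every countable dispersed `ℤ`-poset embeds into one whose order has the extension property. -/
theorem IsDispersed.exists_extRel [Countable B] (h : IsDispersed φ r) :
    ∃ R : B ⊕ ℕ × ℤ → B ⊕ ℕ × ℤ → Prop, IsDispersed (extAct φ) R ∧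
      (∀ x y, R (.inl x) (.inl y) ↔ r x y) ∧ ExtRel R := by
  classical
  -- The extra factor `ℕ` makes every request recur infinitely often, hence also after all its
  -- points have become old.
  obtain ⟨σ, hσ⟩ := exists_surjective_nat
    ((Finset (B ⊕ ℕ × ℤ) × Finset (B ⊕ ℕ × ℤ)) × ℕ)
  let τ := fun n => (σ n).1
  have hτ : ∀ p N, ∃ n ≥ N, τ n = p := by
    intro p N
    have hinf : {n | τ n = p}.Infinite := by
      refine Set.infinite_of_injective_forall_mem (f := fun i : ℕ => (hσ (p, i)).choose) ?_ ?_
      · intro i j hij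
        have := (hσ (p, i)).choose_spec
        rw [show (hσ (p, i)).choose = (hσ (p, j)).choose from hij, (hσ (p, j)).choose_spec] at this
        exact (Prod.ext_iff.1 this).2.symm
      · intro i
        change (σ _).1 = p
        rw [(hσ (p, i)).choose_spec]
    obtain ⟨n, hn, hN⟩ := hinf.exists_gt N
    exact ⟨n, hN.le, hn⟩
  have hS := isDispersed_stageRel h τ
  refine ⟨fun x y => ∃ n, stageRel φ r τ n x y, ⟨(hS 0).1.zero, (hS 0).1.add, ?_, ?_, ?_, ?_, ?_, ?_⟩,
    fun x y => ⟨?_, fun hxy => ⟨0, hxy⟩⟩, ?_⟩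
  · exact fun x => ⟨0, (hS 0).1.refl x⟩
  · rintro x y z ⟨m, h1⟩ ⟨n, h2⟩
    exact ⟨max m n, (hS _).1.trans x y z (stageRel_mono τ (le_max_left m n) h1)
      (stageRel_mono τ (le_max_right m n) h2)⟩
  · rintro x y ⟨m, h1⟩ ⟨n, h2⟩
    exact (hS _).1.antisymm x y (stageRel_mono τ (le_max_left m n) h1)
      (stageRel_mono τ (le_max_right m n) h2)
  · rintro k x y ⟨n, h1⟩
    exact ⟨n, (hS n).1.inv k x y h1⟩
  · rintro k x ⟨n, h1⟩
    exact (hS n).1.free k x h1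
  · intro x y
    obtain ⟨m, hx⟩ := exists_old x
    obtain ⟨n, hy⟩ := exists_old y
    refine ((hS (max m n)).1.finite x y).subset ?_
    rintro k ⟨i, hi⟩
    exact stageRel_of_old τ (hx.mono (le_max_left m n)) ((hy.mono (le_max_right m n)).act k) hi
  · rintro ⟨n, hn⟩
    exact stageRel_of_old (m := 0) τ (x := .inl x) (y := .inl y) trivial trivial hn
  · intro L U F hLU
    obtain ⟨N, hN⟩ := exists_old_finset (L ∪ U ∪ F)
    obtain ⟨n, hn, hnτ⟩ := hτ (L, U) N
    have hL : ∀ l ∈ L, Old n l := fun l hl => (hN l (by simp [hl])).mono hn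
    have hU : ∀ l ∈ U, Old n l := fun l hl => (hN l (by simp [hl])).mono hn
    have hF : ∀ l ∈ F, Old n l := fun l hl => (hN l (by simp [hl])).mono hn
    have hstage : stageRel φ r τ (n + 1) =
        GenericPoset.addOrbit (extAct φ) (stageRel φ r τ n) (.inr (n, 0)) L U := by
      rw [stageRel, hnτ, if_pos]
      refine ⟨hL, hU, fun l hl u hu => ⟨?_, (hLU l hl u hu).2⟩⟩
      obtain ⟨i, hi⟩ := (hLU l hl u hu).1
      exact stageRel_of_old τ (hL l hl) (hU u hu) hi
    have hz : ∀ k, extAct φ k (.inr (n, 0)) = .inr (n, k) := by simp [extAct]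
    have hnz : ∀ a : B ⊕ ℕ × ℤ, Old n a → ∀ k, a ≠ .inr (n, k) := by
      rintro _ ha k rfl
      exact lt_irrefl n ha
    have hold : Old (n + 1) (.inr (n, 0) : B ⊕ ℕ × ℤ) := Nat.lt_succ_self n
    have h0 := (hS n).1.zero
    refine ⟨.inr (n, 0), fun a ha => ⟨⟨?_, ?_⟩, ⟨?_, ?_⟩⟩⟩
    · rintro ⟨i, hi⟩
      have h1 := stageRel_of_old τ ((hF a ha).mono n.le_succ) hold hi
      rw [hstage] at h1
      rcases h1 with h1 | ⟨k, e, l, hl, h1⟩ | ⟨k, e, -⟩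
      · exact (hnz a (hF a ha) 0 ((hS n).2 n le_rfl 0 a (.inl h1))).elim
      · rw [hz] at e
        obtain rfl : 0 = k := by simpa using e
        rw [h0] at h1
        exact ⟨l, hl, n, h1⟩
      · rw [hz] at e
        exact (hnz a (hF a ha) k e).elim
    · rintro ⟨l, hl, i, hi⟩
      refine ⟨n + 1, ?_⟩
      rw [hstage]
      refine .inr (.inl ⟨0, (h0 _).symm, l, hl, ?_⟩)
      rw [h0]
      exact stageRel_of_old τ (hF a ha) (hL l hl) hi
    · rintro ⟨i, hi⟩
      have h1 := stageRel_of_old τ hold ((hF a ha).mono n.le_succ) hi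
      rw [hstage] at h1
      rcases h1 with h1 | ⟨k, e, -⟩ | ⟨k, e, u, hu, h1⟩
      · exact (hnz a (hF a ha) 0 ((hS n).2 n le_rfl 0 a (.inr h1))).elim
      · rw [hz] at e
        exact (hnz a (hF a ha) k e).elim
      · rw [hz] at e
        obtain rfl : 0 = k := by simpa using e
        rw [h0] at h1
        exact ⟨u, hu, n, h1⟩
    · rintro ⟨u, hu, i, hi⟩
      refine ⟨n + 1, ?_⟩
      rw [hstage]
      refine .inr (.inr ⟨0, (h0 _).symm, u, hu, ?_⟩)
      rw [h0]
      exact stageRel_of_old τ (hU u hu) (hF a ha) hi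

end Extension


/-! ### Dispersing automorphisms and their density -/

section Automorphisms

variable {D : Type*} [PartialOrder D]

theorem zpow_neg_apply_zpow (f : D ≃o D) (k : ℤ) (x : D) : (f ^ (-k)) ((f ^ k) x) = x := by
  rw [← RelIso.mul_apply, ← zpow_add, neg_add_cancel, zpow_zero, RelIso.one_apply]

theorem OrbitallyIncomparable.eq_zero_of_le {f : D ≃o D} (hf : OrbitallyIncomparable f) {k : ℤ}
    {x : D} (h : x ≤ (f ^ k) x) : k = 0 := by
  by_contra hk
  exact (hf x k hk).2 h

theorem OrbitallyIncomparable.eq_of_zpow_eq {f : D ≃o D} (hf : OrbitallyIncomparable f) {k : ℤ}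
    {x : D} (h : (f ^ k) x = x) : k = 0 := hf.eq_zero_of_le h.ge

/-- Antisymmetry of `≼` is automatic: after translation, `a ≤ b` and `b` lies below a translate of
`a`. That translate must be `a` itself, so `a = b`. -/
theorem mem_coiAut_iff {f : D ≃o D} : f ∈ coiAut D ↔ OrbitallyIncomparable f := by
  refine ⟨fun h => h.1, fun h => ⟨h, ?_⟩⟩
  have key : ∀ {A : Set.range (orbit f)} {a b : D}, a ∈ (A : Set D) → b ∈ (A : Set D) →
      ∃ k : ℤ, (f ^ k) a = b := by
    rintro ⟨_, x, rfl⟩ _ _ ⟨i, rfl⟩ ⟨j, rfl⟩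
    refine ⟨j - i, ?_⟩
    beta_reduce
    rw [← RelIso.mul_apply, ← zpow_add, sub_add_cancel]
  have act : ∀ {A : Set.range (orbit f)} {a : D}, a ∈ (A : Set D) → ∀ k : ℤ,
      (f ^ k) a ∈ (A : Set D) := by
    rintro ⟨_, x, rfl⟩ _ ⟨i, rfl⟩ k
    exact ⟨k + i, by beta_reduce; rw [zpow_add, RelIso.mul_apply]⟩
  have gen : ∀ {A : Set.range (orbit f)} {a : D}, a ∈ (A : Set D) → (A : Set D) = orbit f a := by
    intro A a ha
    ext b
    exact ⟨fun hb => key ha hb, by rintro ⟨k, rfl⟩; exact act ha k⟩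
  refine { refl := ?_, trans := ?_, antisymm := ?_ }
  · rintro ⟨_, x, rfl⟩
    exact ⟨x, ⟨0, rfl⟩, x, ⟨0, rfl⟩, le_rfl⟩
  · rintro A B C ⟨a, ha, b, hb, hab⟩ ⟨b', hb', c, hc, hbc⟩
    obtain ⟨k, rfl⟩ := key hb hb'
    exact ⟨(f ^ k) a, act ha k, c, hc, ((f ^ k).monotone hab).trans hbc⟩
  · rintro A B ⟨a, ha, b, hb, hab⟩ ⟨b', hb', a', ha', hba⟩
    obtain ⟨k, rfl⟩ := key hb hb'
    obtain ⟨j, hj⟩ := key ha ha'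
    have h1 : (f ^ k) a ≤ (f ^ j) a := by
      rw [hj]
      exact ((f ^ k).monotone hab).trans hba
    have h2 : a ≤ (f ^ (-k + j)) a := by
      have := (f ^ (-k)).monotone h1
      rwa [zpow_neg_apply_zpow, ← RelIso.mul_apply, ← zpow_add] at this
    have hjk : j = k := by
      have := h.eq_zero_of_le h2
      omega
    subst hjk
    rw [← hj] at hba
    have hba' : b ≤ a := (f ^ j).le_iff_le.1 hba
    have hEq : a = b := le_antisymm hab hba'
    apply Subtype.ext
    rw [gen ha, hEq, gen hb]

theorem zpow_eq_of_add {F : ℤ → D ≃o D} (h0 : F 0 = 1) (hadd : ∀ a b, F (a + b) = F a * F b)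
    (k : ℤ) : F 1 ^ k = F k := by
  let Φ : Multiplicative ℤ →* (D ≃o D) :=
    { toFun := fun k => F k.toAdd, map_one' := h0, map_mul' := fun a b => hadd _ _ }
  have := map_zpow Φ (Multiplicative.ofAdd 1) k
  rw [← ofAdd_zsmul] at this
  simpa [Φ] using this.symm

/-- An automorphism all of whose orbits are antichains such that every point is comparable with
only finitely many points of each orbit. -/
abbrev IsDispersing (f : D ≃o D) : Prop :=
  IsDispersed (fun (k : ℤ) (x : D) => (f ^ k) x) (fun x y => x ≤ y)

theorem IsDispersing.orbitallyIncomparable {f : D ≃o D} (hf : IsDispersing f) :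
    OrbitallyIncomparable f := by
  refine fun x k hk => ⟨fun h => hk ?_, fun h => hk (hf.free k x h)⟩
  have h1 := (f ^ (-k)).monotone h
  rw [zpow_neg_apply_zpow] at h1
  have := hf.free (-k) x h1
  omega

theorem IsDispersing.exists_zpow_incomparable {f : D ≃o D} (hf : IsDispersing f) (B : Finset D) :
    ∃ n : ℤ, ∀ x ∈ B, ∀ y ∈ B, ¬ x ≤ (f ^ n) y ∧ ¬ (f ^ n) y ≤ x := by
  have hfin : (⋃ x ∈ (B : Set D), ⋃ y ∈ (B : Set D),
      ({k : ℤ | x ≤ (f ^ k) y} ∪ {k : ℤ | (f ^ k) y ≤ x})).Finite :=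
    B.finite_toSet.biUnion fun x _ => B.finite_toSet.biUnion fun y _ =>
      (hf.finite x y).union (hf.finite_left y x)
  obtain ⟨n, hn⟩ := hfin.exists_notMem
  simp only [Set.mem_iUnion, Set.mem_union, Set.mem_ofPred_eq, not_exists, not_or] at hn
  exact ⟨n, fun x hx y hy => hn x hx y hy⟩

/-- The extension of `B` with the extension property is isomorphic to `D` by an isomorphism
prescribed on `E`; the action is transported along it. -/
theorem IsGeneric.exists_isDispersing (hD : IsGeneric D) {B : Type*} [Countable B]
    {φ : ℤ → B → B} {r : B → B → Prop} (h : IsDispersed φ r) (E : Finset B) (i : B → D)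
    (hi : ∀ x ∈ E, ∀ y ∈ E, r x y ↔ i x ≤ i y) :
    ∃ f : D ≃o D, IsDispersing f ∧ ∀ x ∈ E, ∀ k, φ k x ∈ E → (f ^ k) (i x) = i (φ k x) := by
  have := hD.countable
  obtain ⟨R, hR, hRr, hext⟩ := h.exists_extRel
  let P : PartialOrder (B ⊕ ℕ × ℤ) :=
    { le := R
      lt := fun x y => R x y ∧ ¬ R y x
      lt_iff_le_not_ge := fun _ _ => Iff.rfl
      le_refl := hR.refl
      le_trans := hR.trans
      le_antisymm := hR.antisymm }
  obtain ⟨Φ, hΦ⟩ := @exists_orderIso_of_finite (B ⊕ ℕ × ℤ) D P _ _ _ hext hD.extRel E _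
    (fun x => .inl x) (fun x => i x) (fun x y => (hRr x y).trans (hi x x.2 y y.2))
  have hΦle : ∀ x y, R x y ↔ Φ x ≤ Φ y := fun x y => (Φ.le_iff_le).symm
  let F : ℤ → D ≃o D := fun k =>
    { toFun := fun x => Φ (extAct φ k (Φ.symm x))
      invFun := fun x => Φ (extAct φ (-k) (Φ.symm x))
      left_inv := fun x => by
        beta_reduce
        rw [Φ.symm_apply_apply, ← hR.add, neg_add_cancel, hR.zero, Φ.apply_symm_apply]
      right_inv := fun x => by
        beta_reduce
        rw [Φ.symm_apply_apply, ← hR.add, add_neg_cancel, hR.zero, Φ.apply_symm_apply]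
      map_rel_iff' := fun {x y} => by
        change Φ _ ≤ Φ _ ↔ _
        rw [← hΦle, hR.rel_act_iff, hΦle, Φ.apply_symm_apply, Φ.apply_symm_apply] }
  have hFx : ∀ k x, F k x = Φ (extAct φ k (Φ.symm x)) := fun _ _ => rfl
  have hF0 : F 0 = 1 := by
    ext x
    rw [hFx, hR.zero, Φ.apply_symm_apply, RelIso.one_apply]
  have hFadd : ∀ a b, F (a + b) = F a * F b := by
    intro a b
    ext x
    rw [RelIso.mul_apply, hFx, hFx, hFx, hR.add, Φ.symm_apply_apply]
  have hFk := zpow_eq_of_add hF0 hFadd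
  refine ⟨F 1, ⟨fun x => rfl, fun a b x => ?_, le_refl, fun _ _ _ => le_trans,
    fun _ _ => le_antisymm, fun k _ _ hxy => (F 1 ^ k).monotone hxy, fun k x hx => ?_,
    fun x y => ?_⟩, fun x hx k hk => ?_⟩
  · rw [zpow_add, RelIso.mul_apply]
  · beta_reduce at hx
    rw [hFk, hFx, ← Φ.symm_apply_le] at hx
    exact hR.free k _ hx
  · refine (hR.finite (Φ.symm x) (Φ.symm y)).subset fun k hk => ?_
    have hk' : x ≤ (F 1 ^ k) y := hk
    rw [hFk, hFx, ← Φ.symm_apply_le] at hk'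
    exact hk'
  · rw [hFk, hFx, ← hΦ ⟨x, hx⟩, Φ.symm_apply_apply, ← hΦ ⟨φ k x, hk⟩]
    rfl

/-- A free action of the powers of `f` admits an equivariant map to `ℤ`. -/
theorem OrbitallyIncomparable.exists_index {f : D ≃o D} (hf : OrbitallyIncomparable f) :
    ∃ θ : D → ℤ, ∀ k x, θ ((f ^ k) x) = k + θ x := by
  let S : Setoid D :=
    { r := fun x y => ∃ k : ℤ, (f ^ k) x = y
      iseqv :=
        { refl := fun x => ⟨0, rfl⟩
          symm := by
            rintro x y ⟨k, rfl⟩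
            exact ⟨-k, zpow_neg_apply_zpow f k x⟩
          trans := by
            rintro x y z ⟨k, rfl⟩ ⟨j, rfl⟩
            exact ⟨j + k, by rw [zpow_add, RelIso.mul_apply]⟩ } }
  have hS : ∀ x, ∃ k : ℤ, (f ^ k) (Quotient.out (Quotient.mk S x)) = x := fun x =>
    Quotient.mk_out (s := S) x
  choose θ hθ using hS
  refine ⟨θ, fun k x => ?_⟩
  have hq : Quotient.mk S ((f ^ k) x) = Quotient.mk S x := 
    (Quotient.sound (show S x ((f ^ k) x) from ⟨k, rfl⟩)).symm
  have h1 := hθ ((f ^ k) x)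
  rw [hq] at h1
  have h2 : (f ^ (-(k + θ x) + θ ((f ^ k) x))) (Quotient.mk S x).out = (Quotient.mk S x).out := by
    have h3 : (f ^ (k + θ x)) (Quotient.mk S x).out = (f ^ k) x := by
      rw [zpow_add, RelIso.mul_apply, hθ]
    rw [zpow_add, RelIso.mul_apply, h1, ← h3, zpow_neg_apply_zpow]
  have := hf.eq_of_zpow_eq h2
  omega

/-- Only the order has to be weakened, not `f`: a comparability is kept only if the difference of
the indices `θ` is bounded by the growth of an orbit invariant `ρ`, which jumps by at least `N` at
each strict comparability in `E`. -/
theorem IsGeneric.exists_isDispersing_agree (hD : IsGeneric D) {f : D ≃o D}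
    (hf : OrbitallyIncomparable f) (A : Finset D) :
    ∃ f' : D ≃o D, IsDispersing f' ∧ ∀ x ∈ A, f' x = f x := by
  classical
  have := hD.countable
  obtain ⟨θ, hθ⟩ := hf.exists_index
  let E : Finset D := A ∪ A.image f
  let N : ℕ := ∑ p ∈ E ×ˢ E, (θ p.2 - θ p.1).natAbs
  have hN : ∀ x ∈ E, ∀ y ∈ E, |θ y - θ x| ≤ N := by
    intro x hx y hy
    rw [Int.abs_eq_natAbs, Int.ofNat_le]
    exact Finset.single_le_sum (f := fun p : D × D => (θ p.2 - θ p.1).natAbs)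
      (fun _ _ => Nat.zero_le _) (Finset.mk_mem_product hx hy)
  let S : D → Finset D := fun x => E.filter fun e => ∃ k : ℤ, e ≤ (f ^ k) x
  have hSact : ∀ (k : ℤ) x, S ((f ^ k) x) = S x := by
    intro k x
    refine Finset.filter_congr fun e _ => ⟨?_, ?_⟩
    · rintro ⟨j, hj⟩
      exact ⟨j + k, by rwa [zpow_add, RelIso.mul_apply]⟩
    · rintro ⟨j, hj⟩
      exact ⟨j - k, by rwa [← RelIso.mul_apply, ← zpow_add, sub_add_cancel]⟩
  have hSmono : ∀ x y, x ≤ y → S x ⊆ S y := by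
    intro x y hxy e he
    rw [Finset.mem_filter] at he ⊢
    obtain ⟨he, k, hk⟩ := he
    exact ⟨he, k, hk.trans ((f ^ k).monotone hxy)⟩
  let ρ : D → ℤ := fun x => N * (S x).card
  have hρ : ∀ (k : ℤ) x, ρ ((f ^ k) x) = ρ x := fun k x => by simp only [ρ, hSact]
  -- Since `ρ` is constant on orbits, the bound leaves finitely many exponents for each pair; the
  -- triangle inequality gives transitivity.
  let r : D → D → Prop := fun x y => x ≤ y ∧ |θ y - θ x| ≤ ρ y - ρ x
  have hr : IsDispersed (fun (k : ℤ) (x : D) => (f ^ k) x) r := by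
    refine ⟨fun x => rfl, fun a b x => ?_, fun x => ⟨le_rfl, by simp⟩, ?_, ?_, ?_, ?_, ?_⟩
    · rw [zpow_add, RelIso.mul_apply]
    · rintro x y z ⟨h1, h1'⟩ ⟨h2, h2'⟩
      refine ⟨h1.trans h2, ?_⟩
      rw [abs_le] at *
      constructor <;> linarith [h1'.1, h1'.2, h2'.1, h2'.2]
    · rintro x y ⟨h1, -⟩ ⟨h2, -⟩
      exact le_antisymm h1 h2
    · rintro k x y ⟨h1, h1'⟩
      refine ⟨(f ^ k).monotone h1, ?_⟩
      rw [hρ, hρ, hθ, hθ, add_sub_add_left_eq_sub]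
      exact h1'
    · rintro k x ⟨h1, -⟩
      exact hf.eq_zero_of_le h1
    · intro x y
      refine (Set.finite_Icc (-(ρ y - ρ x) - θ y + θ x) (ρ y - ρ x - θ y + θ x)).subset ?_
      rintro k ⟨-, h1⟩
      rw [hρ, hθ, abs_le] at h1
      constructor <;> linarith [h1.1, h1.2]
  have hE : ∀ x ∈ E, ∀ y ∈ E, r x y ↔ id x ≤ id y := by
    refine fun x hx y hy => ⟨fun h => h.1, fun hxy => ⟨hxy, ?_⟩⟩
    rcases eq_or_ne x y with rfl | hne
    · simp
    · refine (hN x hx y hy).trans ?_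
      -- The point `y` itself is gained: `y ≤ (f ^ k) x` together with `x ≤ y` would force `k = 0`
      -- and `x = y`.
      have hlt : (S x).card < (S y).card := by
        refine Finset.card_lt_card ((Finset.ssubset_iff_of_subset (hSmono x y hxy)).2 ⟨y, ?_, ?_⟩)
        · exact Finset.mem_filter.2 ⟨hy, 0, le_rfl⟩
        · intro h
          obtain ⟨-, k, hk⟩ := Finset.mem_filter.1 h
          obtain rfl := hf.eq_zero_of_le (hxy.trans hk)
          exact hne (le_antisymm hxy hk)
      have h1 : ((S x).card : ℤ) + 1 ≤ (S y).card := by exact_mod_cast hlt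
      have h2 := mul_le_mul_of_nonneg_left h1 (Int.natCast_nonneg N)
      simp only [ρ]
      linarith
  obtain ⟨f', hf', h⟩ := hD.exists_isDispersing hr E id hE
  refine ⟨f', hf', fun x hx => ?_⟩
  have := h x (Finset.mem_union_left _ hx) 1
    (Finset.mem_union_right _ (by simpa using Finset.mem_image_of_mem f hx))
  simpa using this

theorem IsGeneric.exists_isDispersing_auto (hD : IsGeneric D) : ∃ f : D ≃o D, IsDispersing f := by
  have h : IsDispersed (fun (_ : ℤ) (x : Empty) => x) (fun _ _ => True) := by
    constructor <;> first | exact fun x => x.elim | exact fun _ x => x.elim |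
      exact fun _ _ x => x.elim
  obtain ⟨f, hf, -⟩ := hD.exists_isDispersing h ∅ Empty.elim (by simp)
  exact ⟨f, hf⟩

/-- If `f ^ n` moves a large finite set away from itself, any automorphism can be modified outside
`A` so that its conjugate by `f ^ n` prescribes `h` on `C`. -/
theorem IsGeneric.exists_agree_conj (hD : IsGeneric D) {f : D ≃o D} (g h : D ≃o D)
    (A C : Finset D) {n : ℤ}
    (hn : ∀ x ∈ A, ∀ y ∈ C, (¬ x ≤ (f ^ n) y ∧ ¬ (f ^ n) y ≤ x) ∧
      ¬ g x ≤ (f ^ n) (h y) ∧ ¬ (f ^ n) (h y) ≤ g x) :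
    ∃ g' : D ≃o D, (∀ x ∈ A, g' x = g x) ∧
      ∀ x ∈ C, (f ^ (-n) * g' * f ^ n) x = h x := by
  have := hD.countable
  obtain ⟨e, he⟩ := exists_orderIso_of_finite hD.extRel hD.extRel (ι := A ⊕ C)
    (Sum.elim (fun x => x) fun x => (f ^ n) x) (Sum.elim (fun x => g x) fun x => (f ^ n) (h x)) (by
      rintro (x | x) (y | y)
      · simp
      -- Cross pairs are incomparable both before and after, so the two partial maps do not
      -- interact.
      · exact iff_of_false (hn x x.2 y y.2).1.1 (hn x x.2 y y.2).2.1
      · exact iff_of_false (hn y y.2 x x.2).1.2 (hn y y.2 x x.2).2.2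
      · simp)
  refine ⟨e, fun x hx => he (.inl ⟨x, hx⟩), fun x hx => ?_⟩
  have h1 : e ((f ^ n) x) = (f ^ n) (h x) := he (.inr ⟨x, hx⟩)
  rw [RelIso.mul_apply, RelIso.mul_apply, h1, zpow_neg_apply_zpow]

end Automorphisms


/-! ### Reduced words move some point -/

section Freeness

variable {D : Type*} [PartialOrder D]

/-- The value of a word in two letters at `f` and `g`. -/
def wordVal (f g : D ≃o D) (L : List (Fin 2 × Bool)) : D ≃o D :=
  (L.map fun a => cond a.2 (![f, g] a.1) (![f, g] a.1)⁻¹).prod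

theorem wordVal_cons (f g : D ≃o D) (a : Fin 2 × Bool) (L : List (Fin 2 × Bool)) (x : D) :
    wordVal f g (a :: L) x = (cond a.2 (![f, g] a.1) (![f, g] a.1)⁻¹) (wordVal f g L x) := rfl

theorem head?_ne_of_isReduced {a : Fin 2 × Bool} {L : List (Fin 2 × Bool)}
    (h : FreeGroup.IsReduced (a :: L)) : L.head? ≠ some (a.1, !a.2) := by
  rcases L with _ | ⟨b, L⟩
  · simp
  · rw [FreeGroup.isReduced_cons_cons] at h
    rintro e
    obtain rfl : b = (a.1, !a.2) := by simpa using e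
    simpa using h.1 rfl

/-- The domain of the restriction to `A` of `g`, or of the inverse of this restriction. -/
def signedDom [DecidableEq D] (b : Bool) (g : D ≃o D) (A : Finset D) : Finset D :=
  cond b A (A.image g)

/-- The sign `1` or `-1` encoded by a boolean. -/
def signInt (b : Bool) : ℤ := cond b 1 (-1)

theorem zpow_signInt (f : D ≃o D) (b : Bool) : f ^ signInt b = cond b f f⁻¹ := by
  cases b <;> simp [signInt]

/-- Performs one letter `g` or `g⁻¹` at a point where it is still undecided. The inclusions record
that only `y` and `y'` are added to the points in use, and only `y` to the domain of that letter. -/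
theorem IsGeneric.exists_signed_agree_fresh [DecidableEq D] (hD : IsGeneric D) (g : D ≃o D)
    (A G : Finset D) (b : Bool) {y : D} (hy : y ∉ signedDom b g A) :
    ∃ (g' : D ≃o D) (y' : D) (A' : Finset D), A ⊆ A' ∧ (∀ a ∈ A, g' a = g a) ∧ y' ∉ G ∧
      (∀ h : D ≃o D, (∀ a ∈ A', h a = g' a) → (cond b h h⁻¹) y = y') ∧
      A' ∪ A'.image g' ⊆ insert y' (insert y (A ∪ A.image g)) ∧
      signedDom b g' A' ⊆ insert y (signedDom b g A) := by
  cases b with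
  | true =>
    obtain ⟨g', h1, h2⟩ := hD.exists_agree_fresh g A hy G
    have himg : A.image g' = A.image g := Finset.image_congr h1
    refine ⟨g', g' y, insert y A, Finset.subset_insert _ _, h1, h2,
      fun h hh => hh y (Finset.mem_insert_self _ _), ?_, subset_rfl⟩
    rw [Finset.image_insert, himg]
    intro z
    simp only [Finset.mem_union, Finset.mem_insert]
    tauto
  | false =>
    obtain ⟨k, h1, h2⟩ := hD.exists_agree_fresh g⁻¹ (A.image g) hy G
    have h1' : ∀ a ∈ A, k⁻¹ a = g a := by
      intro a ha
      have h3 := h1 (g a) (Finset.mem_image_of_mem g ha)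
      rw [RelIso.inv_apply_self] at h3
      rw [← h3, RelIso.inv_apply_self, h3]
    have hk : k⁻¹ (k y) = y := RelIso.inv_apply_self k y
    have himg : (insert (k y) A).image ⇑k⁻¹ = insert y (A.image g) := by
      rw [Finset.image_insert, hk, Finset.image_congr h1']
    refine ⟨k⁻¹, k y, insert (k y) A, Finset.subset_insert _ _, h1', h2, fun h hh => ?_, ?_, ?_⟩
    · have h4 := hh (k y) (Finset.mem_insert_self _ _)
      rw [hk] at h4
      conv_lhs => rw [← h4]
      exact RelIso.inv_apply_self h (k y)
    · rw [himg]
      intro z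
      simp only [Finset.mem_union, Finset.mem_insert]
      tauto
    · exact himg.subset

/-- The points whose translate by some `f ^ k` with `|k| ≤ N` lies in `F`. -/
noncomputable def translates [DecidableEq D] (f : D ≃o D) (N : ℕ) (F : Finset D) : Finset D :=
  (Finset.Icc (-N : ℤ) N ×ˢ F).image fun p => (f ^ p.1) p.2

theorem mem_translates [DecidableEq D] {f : D ≃o D} {N : ℕ} {F : Finset D} {y : D} {k : ℤ}
    (hk : |k| ≤ N) (h : (f ^ k) y ∈ F) : y ∈ translates f N F := by
  rw [translates, Finset.mem_image]
  refine ⟨(-k, (f ^ k) y), Finset.mk_mem_product ?_ h, zpow_neg_apply_zpow f k y⟩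
  rw [Finset.mem_Icc]
  rw [abs_le] at hk
  constructor <;> linarith [hk.1, hk.2]

theorem abs_signInt_mul (b : Bool) (j : ℕ) : |signInt b * j| = j := by
  cases b <;> simp [signInt]

/-- The word acts from its last letter, so the induction prepends letters. The conditions on
`L.head?` restrict freshness to a next letter that does not cancel, and `N` is the number of further
`f`-steps along which the end point must stay fresh. -/
theorem IsGeneric.exists_wordVal_fresh [DecidableEq D] (hD : IsGeneric D) {f : D ≃o D}
    (hf : OrbitallyIncomparable f) (g₀ : D ≃o D) (A₀ : Finset D) (L : List (Fin 2 × Bool))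
    (hL : FreeGroup.IsReduced L) (N : ℕ) :
    ∃ (g : D ≃o D) (A : Finset D) (x y : D), A₀ ⊆ A ∧ (∀ a ∈ A₀, g a = g₀ a) ∧
      (∀ h : D ≃o D, (∀ a ∈ A, h a = g a) → wordVal f h L x = y) ∧ (L ≠ [] → y ≠ x) ∧
      (∀ b, L.head? ≠ some (0, !b) → ∀ j : ℕ, 1 ≤ j → j ≤ N →
        (f ^ (signInt b * j)) y ∉ insert x (A ∪ A.image g)) ∧
      ∀ b, L.head? ≠ some (1, !b) → y ∉ signedDom b g A := by
  have hdom : ∀ (b : Bool) (g : D ≃o D) (A : Finset D), signedDom b g A ⊆ A ∪ A.image g := by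
    rintro (_ | _) g A
    · exact Finset.subset_union_right
    · exact Finset.subset_union_left
  have hsign : ∀ (b : Bool) (j : ℕ), 1 ≤ j → signInt b * j ≠ 0 := by
    rintro (_ | _) j hj <;> simp [signInt] <;> omega
  have hhd : ∀ {c : Fin 2} (b b' : Bool) (L : List (Fin 2 × Bool)),
      ((c, b) :: L).head? ≠ some (c, !b') → b = b' := by
    rintro c (_ | _) (_ | _) L h <;> simp_all
  induction L generalizing N with
  | nil =>
    obtain ⟨x, hx⟩ := hD.exists_notMem (translates f N (A₀ ∪ A₀.image g₀))
    refine ⟨g₀, A₀, x, x, subset_rfl, fun _ _ => rfl, fun _ _ => rfl, fun h => (h rfl).elim,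
      fun b _ j hj hjN h => ?_, fun b _ h => ?_⟩
    · rw [Finset.mem_insert] at h
      rcases h with h | h
      · exact hsign b j hj (hf.eq_of_zpow_eq h)
      · refine hx (mem_translates ?_ h)
        rw [abs_signInt_mul]
        exact_mod_cast hjN
    · exact hx (mem_translates (k := 0) (by simp) (hdom b _ _ h))
  | cons a L ih =>
    have hhead := head?_ne_of_isReduced hL
    have hL' : FreeGroup.IsReduced L := List.IsChain.tail hL
    obtain ⟨c, b⟩ := a
    -- A letter `f` or `f⁻¹` uses up one step of freshness, hence `N + 1`.
    obtain ⟨g, A, x, y, hA, hg, hval, hyx, hfr, hgr⟩ := ih hL' (N + 1)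
    obtain rfl | rfl : c = 0 ∨ c = 1 := by fin_cases c <;> simp
    · have hfr' := hfr b hhead
      have hpow : ∀ j : ℕ, (f ^ (signInt b * j)) ((f ^ signInt b) y) =
          (f ^ (signInt b * (j + 1 : ℕ))) y := by
        intro j
        rw [← RelIso.mul_apply, ← zpow_add]
        push_cast
        rw [mul_add, mul_one]
      have h0 : (f ^ signInt b) y ∉ insert x (A ∪ A.image g) := by
        simpa using hfr' 1 le_rfl (by omega)
      rw [Finset.mem_insert, not_or] at h0
      refine ⟨g, A, x, (f ^ signInt b) y, hA, hg, fun h hh => ?_, fun _ => h0.1,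
        fun b' hb' j hj hjN => ?_, fun b' _ hb' => h0.2 (hdom b' g A hb')⟩
      · rw [wordVal_cons, hval h hh, zpow_signInt]
        rfl
      · obtain rfl := hhd _ _ _ hb'
        rw [hpow]
        exact hfr' (j + 1) (by omega) (by omega)
    · have hy := hgr b hhead
      obtain ⟨g', y', A', hAA', hagree, hy', hval', hF, hdom'⟩ := hD.exists_signed_agree_fresh g A
        (translates f N (insert x (insert y (A ∪ A.image g)))) b hy
      have hfresh : ∀ k : ℤ, |k| ≤ N → (f ^ k) y' ∉ insert x (insert y (A ∪ A.image g)) :=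
        fun k hk h => hy' (mem_translates hk h)
      have h0 : y' ∉ insert x (insert y (A ∪ A.image g)) := hfresh 0 (by simp)
      refine ⟨g', A', x, y', hA.trans hAA', fun a ha => (hagree a (hA ha)).trans (hg a ha),
        fun h hh => ?_, fun _ e => h0 (e ▸ Finset.mem_insert_self _ _),
        fun b' _ j hj hjN h => ?_, fun b' hb' h => ?_⟩
      · rw [wordVal_cons, hval h fun a ha => (hh a (hAA' ha)).trans (hagree a ha)]
        exact hval' h hh
      · have hk := hfresh (signInt b' * j) (by rw [abs_signInt_mul]; exact_mod_cast hjN)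
        rw [Finset.mem_insert] at h
        rcases h with h | h
        · exact hk (h ▸ Finset.mem_insert_self _ _)
        · have h2 := hF h
          rw [Finset.mem_insert] at h2
          rcases h2 with h2 | h2
          · exact hsign b' j hj (hf.eq_of_zpow_eq h2)
          · exact hk (Finset.mem_insert_of_mem h2)
      -- The next letter has the same sign, and its domain has grown only by `y`, which differs from
      -- the fresh point `y'`.
      · obtain rfl := hhd _ _ _ hb'
        have h2 := hdom' h
        refine h0 (Finset.mem_insert_of_mem ?_)
        rw [Finset.mem_insert] at h2 ⊢
        exact h2.imp_right fun h3 => hdom _ _ _ h3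

theorem IsGeneric.exists_agree_lift_ne (hD : IsGeneric D) {f : D ≃o D}
    (hf : OrbitallyIncomparable f) (g₀ : D ≃o D) (A : Finset D) {w : FreeGroup (Fin 2)}
    (hw : w ≠ 1) : ∃ g : D ≃o D, (∀ a ∈ A, g a = g₀ a) ∧ FreeGroup.lift ![f, g] w ≠ 1 := by
  classical
  obtain ⟨g, A', x, y, -, hg, hval, hyx, -⟩ :=
    hD.exists_wordVal_fresh hf g₀ A w.toWord FreeGroup.isReduced_toWord 0
  refine ⟨g, hg, fun h => hyx (fun e => hw (FreeGroup.toWord_eq_nil_iff.1 e)) ?_⟩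
  rw [← hval g fun _ _ => rfl]
  have : wordVal f g w.toWord = FreeGroup.lift ![f, g] w := by
    conv_rhs => rw [← FreeGroup.mk_toWord (x := w), FreeGroup.lift_mk]
    rfl
  rw [this, h, RelIso.one_apply]

end Freeness

/-! ### Topology and comeagerness -/

section Topology

variable {D : Type*} [PartialOrder D]

theorem isOpen_setOf_apply (x : D) (Q : D → Prop) : IsOpen {f : D ≃o D | Q (f x)} := by
  let _ : TopologicalSpace D := ⊥
  have _ : DiscreteTopology D := ⟨rfl⟩
  have h : Continuous fun f : D ≃o D => f x :=
    (continuous_apply x).comp continuous_induced_dom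
  exact (isOpen_discrete {y | Q y}).preimage h

theorem exists_finset_agree {U : Set (D ≃o D)} (hU : IsOpen U) {g : D ≃o D} (hg : g ∈ U) :
    ∃ A : Finset D, ∀ h : D ≃o D, (∀ a ∈ A, h a = g a) → h ∈ U := by
  let _ : TopologicalSpace D := ⊥
  obtain ⟨V, hV, rfl⟩ := isOpen_induced_iff.1 hU
  obtain ⟨I, u, hu, huV⟩ := isOpen_pi_iff.1 hV _ hg
  refine ⟨I, fun h hh => huV fun a ha => ?_⟩
  change h a ∈ u a
  rw [hh a ha]
  exact (hu a ha).2

theorem continuous_auto {Y : Type*} [TopologicalSpace Y] {F : Y → D ≃o D}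
    (h : ∀ x y, IsOpen {p | F p x = y}) : Continuous F := by
  let _ : TopologicalSpace D := ⊥
  have _ : DiscreteTopology D := ⟨rfl⟩
  exact continuous_induced_rng.2 (continuous_pi fun x => continuous_discrete_rng.2 fun y => h x y)

theorem isTopologicalGroup_auto : IsTopologicalGroup (D ≃o D) where
  continuous_mul := by
    refine continuous_auto fun x y => ?_
    have : {p : (D ≃o D) × (D ≃o D) | (p.1 * p.2) x = y} =
        ⋃ z, Prod.fst ⁻¹' {f | f z = y} ∩ Prod.snd ⁻¹' {f | f x = z} := by
      ext p
      simp [RelIso.mul_apply]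
    rw [this]
    exact isOpen_iUnion fun z => ((isOpen_setOf_apply z (· = y)).preimage continuous_fst).inter
      ((isOpen_setOf_apply x (· = z)).preimage continuous_snd)
  continuous_inv := by
    refine continuous_auto fun x y => ?_
    have : {f : D ≃o D | f⁻¹ x = y} = {f | f y = x} := by
      ext f
      constructor
      · rintro rfl
        exact RelIso.apply_inv_self f x
      · rintro rfl
        exact RelIso.inv_apply_self f y
    rw [this]
    exact isOpen_setOf_apply y (· = x)

attribute [local instance] isTopologicalGroup_auto

theorem isGδ_coiAut [Countable D] : IsGδ (coiAut D) := by
  have : coiAut D = ⋂ (x : D) (k : {k : ℤ // k ≠ 0}),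
      {f : D ≃o D | ¬ (f ^ (k : ℤ)) x ≤ x ∧ ¬ x ≤ (f ^ (k : ℤ)) x} := by
    ext f
    rw [mem_coiAut_iff]
    simp only [Set.mem_iInter, Subtype.forall]
    exact Iff.rfl
  rw [this]
  exact IsGδ.iInter fun x => IsGδ.iInter_of_isOpen fun k =>
    (isOpen_setOf_apply x fun y => ¬ y ≤ x ∧ ¬ x ≤ y).preimage (continuous_zpow k.1)

theorem continuous_lift_pair {G Y : Type*} [Group G] [TopologicalSpace G] [IsTopologicalGroup G]
    [TopologicalSpace Y] {F F' : Y → G} (hF : Continuous F) (hF' : Continuous F')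
    (w : FreeGroup (Fin 2)) : Continuous fun p => FreeGroup.lift ![F p, F' p] w := by
  induction w using FreeGroup.induction_on with
  | C1 => simpa using continuous_const
  | of i => fin_cases i <;> simpa
  | inv_of i h =>
    simp only [map_inv]
    exact h.inv
  | mul x y hx hy =>
    simp only [map_mul]
    exact hx.mul hy

theorem lift_pair_mem_closure {G : Type*} [Group G] (f g : G) (w : FreeGroup (Fin 2)) :
    FreeGroup.lift ![f, g] w ∈ Subgroup.closure {f, g} := by
  have h : FreeGroup.lift ![f, g] w ∈ (FreeGroup.lift ![f, g]).range := ⟨w, rfl⟩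
  rwa [FreeGroup.range_lift_eq_closure, Matrix.range_cons_cons_empty] at h

theorem isOpen_forall_finset {Y : Type*} [TopologicalSpace Y] {F : Y → D ≃o D}
    (hF : Continuous F) (s : Finset (D × D)) : IsOpen {p | ∀ q ∈ s, F p q.1 = q.2} := by
  have : {p | ∀ q ∈ s, F p q.1 = q.2} = ⋂ q ∈ s, F ⁻¹' {f | f q.1 = q.2} := by
    ext p
    simp
  rw [this]
  exact isOpen_biInter_finset fun q _ => (isOpen_setOf_apply q.1 (· = q.2)).preimage hF

theorem isOpen_imp_of {Y : Type*} [TopologicalSpace Y] (P : Prop) {S : Set Y} (hS : IsOpen S) :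
    IsOpen {p | P → p ∈ S} := by
  by_cases hP : P
  · simpa [hP] using hS
  · simp [hP]

/-- There is one dense open condition for each nontrivial word (it is not killed) and one for each
finite set of pairs (if an automorphism extends it, so does some word). Density needs only a change
of `g` in the first case, and a dispersing approximation of `f` as well in the second. -/
theorem IsGeneric.freelyGenerateDense_mem_residual (hD : IsGeneric D) :
    {p : coiAut D × (D ≃o D) | FreelyGenerateDense (p.1 : D ≃o D) p.2} ∈
      residual (coiAut D × (D ≃o D)) := by
  classical
  have := hD.countable
  have : Countable (FreeGroup (Fin 2)) := FreeGroup.toWord_injective.countable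
  have hc : ∀ w, Continuous fun p : coiAut D × (D ≃o D) =>
      FreeGroup.lift ![(p.1 : D ≃o D), p.2] w :=
    continuous_lift_pair (continuous_subtype_val.comp continuous_fst) continuous_snd
  have hfree : ∀ w : {w : FreeGroup (Fin 2) // w ≠ 1},
      {p : coiAut D × (D ≃o D) | FreeGroup.lift ![(p.1 : D ≃o D), p.2] w ≠ 1} ∈
        residual (coiAut D × (D ≃o D)) := by
    rintro ⟨w, hw⟩
    apply residual_of_dense_open
    · have : {p : coiAut D × (D ≃o D) | FreeGroup.lift ![(p.1 : D ≃o D), p.2] w ≠ 1} =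
          ⋃ x, (fun p : coiAut D × (D ≃o D) => FreeGroup.lift ![(p.1 : D ≃o D), p.2] w) ⁻¹'
            {f | f x ≠ x} := by
        ext p
        simp [DFunLike.ext_iff]
      rw [this]
      exact isOpen_iUnion fun x => (isOpen_setOf_apply x (· ≠ x)).preimage (hc w)
    · rw [dense_iff_inter_open]
      rintro U hU ⟨⟨f, g⟩, hfg⟩
      obtain ⟨A, hA⟩ := exists_finset_agree (hU.preimage (Continuous.prodMk_right f)) hfg
      obtain ⟨g', hg', hne⟩ := hD.exists_agree_lift_ne (mem_coiAut_iff.1 f.2) g A hw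
      exact ⟨(f, g'), hA g' hg', hne⟩
  have hdense : ∀ s : Finset (D × D), {p : coiAut D × (D ≃o D) |
      (∃ h : D ≃o D, ∀ q ∈ s, h q.1 = q.2) →
        p ∈ ⋃ w, {p : coiAut D × (D ≃o D) |
          ∀ q ∈ s, FreeGroup.lift ![(p.1 : D ≃o D), p.2] w q.1 = q.2}} ∈
        residual (coiAut D × (D ≃o D)) := by
    intro s
    apply residual_of_dense_open
    · exact isOpen_imp_of _ (isOpen_iUnion fun w => isOpen_forall_finset (hc w) s)
    · rw [dense_iff_inter_open]
      rintro U hU ⟨⟨⟨f, hf⟩, g⟩, hfg⟩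
      by_cases hs : ∃ h : D ≃o D, ∀ q ∈ s, h q.1 = q.2
      swap
      · exact ⟨_, hfg, fun h => (hs h).elim⟩
      obtain ⟨h, hh⟩ := hs
      obtain ⟨V, W, hV, hW, hfV, hgW, hVW⟩ := isOpen_prod_iff.1 hU _ _ hfg
      obtain ⟨V', hV', rfl⟩ := isOpen_induced_iff.1 hV
      obtain ⟨A₁, hA₁⟩ := exists_finset_agree hV' hfV
      obtain ⟨A₂, hA₂⟩ := exists_finset_agree hW hgW
      obtain ⟨f', hf', hff'⟩ := hD.exists_isDispersing_agree (mem_coiAut_iff.1 hf) A₁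
      let C := s.image Prod.fst
      obtain ⟨n, hn⟩ := hf'.exists_zpow_incomparable (A₂ ∪ A₂.image g ∪ C ∪ C.image h)
      obtain ⟨g', hg', hconj⟩ := hD.exists_agree_conj (f := f') g h A₂ C (n := n) (by
        intro x hx y hy
        exact ⟨hn _ (by simp [hx]) _ (by simp [hy]),
          hn _ (by simp only [Finset.mem_union]; simp [hx])
            _ (Finset.mem_union_right _ (Finset.mem_image_of_mem h hy))⟩)
      refine ⟨(⟨f', mem_coiAut_iff.2 hf'.orbitallyIncomparable⟩, g'),
        hVW ⟨hA₁ f' hff', hA₂ g' hg'⟩, fun _ => Set.mem_iUnion.2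
          ⟨FreeGroup.of 0 ^ (-n) * FreeGroup.of 1 * FreeGroup.of 0 ^ n, fun q hq => ?_⟩⟩
      rw [← hh q hq, ← hconj q.1 (Finset.mem_image_of_mem _ hq)]
      simp
  filter_upwards [countable_iInter_mem.2 hfree, countable_iInter_mem.2 hdense] with p h1 h2
  rw [Set.mem_iInter] at h1 h2
  refine ⟨(injective_iff_map_eq_one _).2 fun w hw => ?_, ?_⟩
  · by_contra hne
    exact h1 ⟨w, hne⟩ hw
  · rw [dense_iff_inter_open]
    rintro U hU ⟨h, hh⟩
    obtain ⟨A, hA⟩ := exists_finset_agree hU hh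
    have hs : ∀ q ∈ A.image fun a => (a, h a), h q.1 = q.2 := by simp
    obtain ⟨w, hw⟩ := Set.mem_iUnion.1 (h2 _ ⟨h, hs⟩)
    exact ⟨_, hA _ fun a ha => hw (a, h a) (Finset.mem_image_of_mem _ ha),
      lift_pair_mem_closure _ _ w⟩

theorem exists_finset_agree_pi {m : ℕ} {U : Set (Fin m → (D ≃o D))} (hU : IsOpen U)
    {g : Fin m → (D ≃o D)} (hg : g ∈ U) :
    ∃ A : Finset D, ∀ h : Fin m → (D ≃o D), (∀ i, ∀ a ∈ A, h i a = g i a) → h ∈ U := by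
  classical
  obtain ⟨I, u, hu, huU⟩ := isOpen_pi_iff.1 hU _ hg
  choose! A hA using fun i hi => exists_finset_agree (hu i hi).1 (hu i hi).2
  refine ⟨I.biUnion A, fun h hh => huU fun i hi => hA i hi _ fun a ha => hh i a ?_⟩
  exact Finset.mem_biUnion.2 ⟨i, hi, ha⟩

/-- A single dispersing `f`, chosen before the tuple, witnesses cyclic density for comeagerly many
tuples. -/
theorem IsGeneric.cyclicallyDense_mem_residual (hD : IsGeneric D) (m : ℕ) :
    {g : Fin m → (D ≃o D) | CyclicallyDense g} ∈ residual (Fin m → (D ≃o D)) := by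
  classical
  have := hD.countable
  obtain ⟨f, hf⟩ := hD.exists_isDispersing_auto
  have hdense : ∀ s : Fin m → Finset (D × D), {g : Fin m → (D ≃o D) |
      (∃ h : Fin m → (D ≃o D), ∀ i, ∀ q ∈ s i, h i q.1 = q.2) →
        g ∈ ⋃ k : ℤ, ⋂ i, {g : Fin m → (D ≃o D) |
          ∀ q ∈ s i, (f ^ k * g i * f ^ (-k)) q.1 = q.2}} ∈ residual (Fin m → (D ≃o D)) := by
    intro s
    apply residual_of_dense_open
    · refine isOpen_imp_of _ (isOpen_iUnion fun k => isOpen_iInter_of_finite fun i =>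
        isOpen_forall_finset ?_ (s i))
      exact (continuous_const.mul (continuous_apply i)).mul continuous_const
    · rw [dense_iff_inter_open]
      rintro U hU ⟨g, hg⟩
      by_cases hs : ∃ h : Fin m → (D ≃o D), ∀ i, ∀ q ∈ s i, h i q.1 = q.2
      swap
      · exact ⟨_, hg, fun h => (hs h).elim⟩
      obtain ⟨h, hh⟩ := hs
      obtain ⟨A, hA⟩ := exists_finset_agree_pi hU hg
      let C : Fin m → Finset D := fun i => (s i).image Prod.fst
      -- The finite sets of all coordinates are united, so that one exponent serves the diagonal
      -- action.
      obtain ⟨n, hn⟩ := hf.exists_zpow_incomparable (Finset.univ.biUnion fun i =>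
        A ∪ A.image (g i) ∪ C i ∪ (C i).image (h i))
      have key : ∀ i, _ := fun i => hD.exists_agree_conj (f := f) (g i) (h i) A (C i) (n := n) (by
        intro x hx y hy
        have hmem : ∀ z ∈ A ∪ A.image (g i) ∪ C i ∪ (C i).image (h i),
            z ∈ Finset.univ.biUnion fun i => A ∪ A.image (g i) ∪ C i ∪ (C i).image (h i) :=
          fun z hz => Finset.mem_biUnion.2 ⟨i, Finset.mem_univ i, hz⟩
        exact ⟨hn _ (hmem _ (by simp [hx])) _ (hmem _ (by simp [hy])),
          hn _ (hmem _ (by simp only [Finset.mem_union]; simp [hx]))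
            _ (hmem _ (Finset.mem_union_right _ (Finset.mem_image_of_mem _ hy)))⟩)
      choose g' hg' hconj using key
      refine ⟨g', hA g' hg', fun _ => Set.mem_iUnion.2 ⟨-n, Set.mem_iInter.2 fun i q hq => ?_⟩⟩
      rw [neg_neg, ← hh i q hq]
      exact hconj i q.1 (Finset.mem_image_of_mem _ hq)
  filter_upwards [countable_iInter_mem.2 hdense] with g h2
  rw [Set.mem_iInter] at h2
  refine ⟨f, ?_⟩
  rw [dense_iff_inter_open]
  rintro U hU ⟨h, hh⟩
  obtain ⟨A, hA⟩ := exists_finset_agree_pi hU hh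
  obtain ⟨k, hk⟩ := Set.mem_iUnion.1 (h2 (fun i => A.image fun a => (a, h i a))
    ⟨h, fun i => by simp⟩)
  rw [Set.mem_iInter] at hk
  exact ⟨_, hA _ fun i a ha => hk i (a, h i a) (Finset.mem_image_of_mem _ ha), k, rfl⟩

end Topology

end GenericPoset

theorem mainTheorem7 {D : Type*} [PartialOrder D] (hD : GenericPoset.IsGeneric D) :
    IsGδ (GenericPoset.coiAut D) ∧
    {p : GenericPoset.coiAut D × (D ≃o D) |
        GenericPoset.FreelyGenerateDense (p.1 : D ≃o D) p.2} ∈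
      residual (GenericPoset.coiAut D × (D ≃o D)) ∧
    ∀ m : ℕ, {g : Fin m → (D ≃o D) | GenericPoset.CyclicallyDense g} ∈
      residual (Fin m → (D ≃o D)) := by
  have := hD.countable
  exact ⟨GenericPoset.isGδ_coiAut, hD.freelyGenerateDense_mem_residual,
    hD.cyclicallyDense_mem_residual⟩
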